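/- Let $N=2^n$ with $n\ge 0$, let $G_2=\begin{bmatrix}1&0\\1&1\end{bmatrix}$ and let $G_N=G_2^{\otimes n}$ over $\mathbb F_2$, with rows $G_N^{(0)},\dots,G_N^{(N-1)}$. Let $W$ be a binary-input memoryless channel with an arbitrary (discrete or general measurable) output alphabet $\mathcal Y$, and let $\mathcal I(W)$ denote its symmetric capacity, i.e. the mutual information between a uniform input bit and the output. For a puncturing pattern $P\in\{0,1\}^N$, a data vector $u\in\{0,1\}^N$ is encoded as $x=uG_N$; for each $j$ with $P(j)=0$ the bit $x_j$ is sent over an independent copy of $W$, which yields $y[P]_j\in\mathcal Y$, and for each $j$ with $P(j)=1$ one sets $y[P]_j=\star$, an extra erasure symbol. For $0\le i\le N-1$ let $W[P]_N^{(i)}$ be the virtual channel with input $u_i$ and output $(y[P]_0^{N-1},u_0^{i-1})$, the bits other than $u_i$ being independent and uniform. The erasure pattern $E[P]\in\{0,1\}^N$ is defined by $E[P](i)=1$ if and only if $\mathcal I(W[P]_N^{(i)})=0$. For $\mathcal L\subseteq\{0,\dots,N-1\}$ let $\bigvee_{i\in\mathcal L}G_N^{(i)}$ be the bitwise OR of the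 rows with index in $\mathcal L$ (the zero vector if $\mathcal L=\emptyset$). **Theorem.** Assume $\mathcal I(W)>0$ and let $P\in\{0,1\}^N$ be a puncturing pattern. 1. $E[P]=P$ if and only if $P$ is the zero vector or there is $\mathcal L\subseteq\{0,\dots,N-1\}$ with $P=\bigvee_{i\in\mathcal L}G_N^{(i)}$. 2. There is $\mathcal L\subseteq\{0,\dots,N-1\}$ with $E[P]=\bigvee_{i\in\mathcal L}G_N^{(i)}$. 3. $E[P]$ does not depend on $W$: every binary-input memoryless channel $W'$ with $\mathcal I(W')>0$ gives the same erasure pattern. -/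

import Mathlib

open MeasureTheory
open scoped ENNReal

noncomputable section

namespace PolarPuncturing

/-- Binary vectors of length `N`, indexed by `0, …, N - 1`. -/
abbrev BinVec (N : ℕ) : Type := Fin N → ZMod 2

/-- The kernel matrix `G₂`. -/
def kernelMatrix : Matrix (Fin 2) (Fin 2) (ZMod 2) := !![1, 0; 1, 1]

/-- The `n`-th Kronecker power `G_N = G₂^{⊗ n}`, `N = 2 ^ n`. The pair `(a, j)` of row (or column)
indices of `G₂ ⊗ G_{N/2}` is identified with the index `a * (N/2) + j`, as usual. -/
def polarMatrix : (n : ℕ) → Matrix (Fin (2 ^ n)) (Fin (2 ^ n)) (ZMod 2)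
  | 0 => 1
  | n + 1 =>
    let e : Fin 2 × Fin (2 ^ n) ≃ Fin (2 ^ (n + 1)) :=
      finProdFinEquiv.trans (finCongr (pow_succ' 2 n).symm)
    Matrix.reindex e e (Matrix.kronecker kernelMatrix (polarMatrix n))

/-- Bitwise OR of the vectors `A l`, `l ∈ L` (the zero vector if `L` is empty). -/
def bitOr {ι : Type*} {N : ℕ} (L : Finset ι) (A : ι → BinVec N) : BinVec N := by
  classical
  exact fun j => if ∃ l ∈ L, A l j = 1 then 1 else 0

/-- The law of the channel output when the input bit is uniform. -/
def outputLaw {Y : Type*} [MeasurableSpace Y] (W : ZMod 2 → Measure Y) : Measure Y :=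
  ∑ x : ZMod 2, (1 / 2 : ℝ≥0∞) • W x

/-- Symmetric capacity, in bits, of the binary-input channel whose output has law `W x` when `x` is
sent: the mutual information between a uniform input bit and the output,
`∑ₓ ½ ∫ log₂ (dW x / dM) dW x` with `M = ½ W 0 + ½ W 1`. -/
def symmetricCapacity {Y : Type*} [MeasurableSpace Y] (W : ZMod 2 → Measure Y) : ℝ≥0∞ :=
  (∑ x : ZMod 2, (1 / 2 : ℝ≥0∞) * InformationTheory.klDiv (W x) (outputLaw W))
    / ENNReal.ofReal (Real.log 2)

/-- The law of the punctured received sequence when the codeword `x` is sent through independent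
uses of `W`. The alphabet is extended by the erasure symbol `Sum.inr ()`, which is
received exactly at the punctured positions. -/
def receivedLaw {Y : Type*} [MeasurableSpace Y] (W : ZMod 2 → Measure Y) {N : ℕ}
    (P x : BinVec N) : Measure (Fin N → Y ⊕ Unit) :=
  Measure.pi fun j =>
    if P j = 1 then Measure.dirac (Sum.inr ()) else (W (x j)).map Sum.inl

/-- The virtual channel with input `u i` and output `(y[P], (u k)_{k < i})`, where the data bits
other than `u i` are uniform and `y[P]` is the punctured received sequence for the codeword
`u · G_N`. -/
def virtualChannel {Y : Type*} [MeasurableSpace Y] (W : ZMod 2 → Measure Y) {n : ℕ}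
    (P : BinVec (2 ^ n)) (i : Fin (2 ^ n)) (b : ZMod 2) :
    Measure ((Fin (2 ^ n) → Y ⊕ Unit) × ({k : Fin (2 ^ n) // k < i} → ZMod 2)) :=
  ∑ u : BinVec (2 ^ n) with u i = b,
    (1 / 2 ^ (2 ^ n - 1) : ℝ≥0∞) •
      (receivedLaw W P (Matrix.vecMul u (polarMatrix n))).map
        (fun y => (y, fun k : {k : Fin (2 ^ n) // k < i} => u k))

/-- The data bit erasure pattern `E[P]`: it marks the positions whose virtual channel has
symmetric capacity zero. -/
def erasurePattern {Y : Type*} [MeasurableSpace Y] (W : ZMod 2 → Measure Y) {n : ℕ}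
    (P : BinVec (2 ^ n)) : BinVec (2 ^ n) := by
  classical
  exact fun i => if symmetricCapacity (virtualChannel W P i) = 0 then 1 else 0

end PolarPuncturing

end

/-! Index the coordinates by subsets of the set of binary digits. Then `G_N` is the inclusion matrix
of subsets, an involution over `𝔽₂` which turns the coefficients of a multilinear polynomial into
its values on the Boolean cube. A combination `h` of the unpunctured code bits that determines `u_i`
from the earlier bits is the value table of a polynomial that vanishes on `P` and has leading
monomial `x^i`. Hence `E[P]` consists of the standard monomials of the vanishing ideal of `P`:
multiplying polynomials by monomials shows that it is a lower set, and it is `P` itself when `P` is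
a lower set, because then already the monomials `x^i` with `i ∉ P` vanish on `P`.

The channel enters only through `W 0 ≠ W 1`. If no such `h` exists, then by duality flipping `u_i`
together with some later bits changes no received bit, so the virtual channel ignores its input. If
`h` exists, an estimator `g` of `(-1)^x` from one channel output which is unbiased for both inputs
gives, by independence, an unbiased estimator `∏ g (y_j)` of `(-1)^(h ⬝ᵥ x)`. -/

namespace PolarPuncturing

open Matrix Function

section Recoverability

variable {ι κ R : Type*}

/-- The bit `i` of the data vector of the linear code with generator matrix `G` is determined by its
predecessors and by the code bits outside `S`: some vector `h`, supported off `S`, combines these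
code bits into `u i` plus a combination of the `u k` with `k < i`. -/
def IsRecoverable [LT ι] [Fintype κ] [Semiring R] (G : Matrix ι κ R) (S : Set κ) (i : ι) : Prop :=
  ∃ h : κ → R, (∀ j ∈ S, h j = 0) ∧ (∀ k, i < k → (G *ᵥ h) k = 0) ∧ (G *ᵥ h) i = 1

theorem isRecoverable_iff_of_mul_self_eq_one [Fintype ι] [DecidableEq ι] [LT ι] [Semiring R]
    {G : Matrix ι ι R} (hG : G * G = 1) {S : Set ι} {i : ι} :
    IsRecoverable G S i ↔
      ∃ v : ι → R, (∀ k, i < k → v k = 0) ∧ v i = 1 ∧ ∀ j ∈ S, (G *ᵥ v) j = 0 := by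
  have hGG (v : ι → R) : G *ᵥ G *ᵥ v = v := by rw [mulVec_mulVec, hG, one_mulVec]
  constructor
  · rintro ⟨h, hS, hlt, hi⟩
    exact ⟨G *ᵥ h, hlt, hi, by rwa [hGG]⟩
  · rintro ⟨v, hlt, hi, hS⟩
    exact ⟨G *ᵥ v, hS, by rwa [hGG], by rwa [hGG]⟩

theorem exists_dotProduct_eq_one_of_notMem [Field R] [Fintype κ] {p : Submodule R (κ → R)}
    {x : κ → R} (hx : x ∉ p) : ∃ h : κ → R, (∀ y ∈ p, y ⬝ᵥ h = 0) ∧ x ⬝ᵥ h = 1 := by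
  classical
  obtain ⟨f, hfx, hfp⟩ := Submodule.exists_le_ker_of_notMem hx
  let h := (dotProductEquiv R κ).symm ((f x)⁻¹ • f)
  have hdot (y : κ → R) : y ⬝ᵥ h = (f x)⁻¹ * f y := by
    rw [dotProduct_comm]
    exact LinearMap.congr_fun ((dotProductEquiv R κ).apply_symm_apply ((f x)⁻¹ • f)) y
  refine ⟨h, fun y hy => ?_, by rw [hdot, inv_mul_cancel₀ hfx]⟩
  rw [hdot, LinearMap.mem_ker.1 (hfp hy), mul_zero]

theorem exists_vecMul_eq_zero_of_not_isRecoverable [Field R] [Fintype ι] [Preorder ι] [Fintype κ]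
    {G : Matrix ι κ R} {S : Set κ} {i : ι} (hi : ¬ IsRecoverable G S i) :
    ∃ w : ι → R, (∀ k, k < i → w k = 0) ∧ w i = 1 ∧ ∀ j ∉ S, (w ᵥ* G) j = 0 := by
  classical
  let row (k : ι) : κ → R := Sᶜ.indicator (G k)
  have row_dotProduct (k : ι) (h : κ → R) : row k ⬝ᵥ h = (G *ᵥ Sᶜ.indicator h) k :=
    Finset.sum_congr rfl fun j _ => by by_cases hj : j ∈ S <;> simp [row, hj]
  have row_mem_span : row i ∈ Submodule.span R (row '' ({k | i < k} : Finset ι)) := by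
    by_contra hmem
    obtain ⟨h, hlt, h_one⟩ := exists_dotProduct_eq_one_of_notMem hmem
    refine hi ⟨Sᶜ.indicator h, fun j hj => by simp [hj], fun k hk => ?_, ?_⟩
    · rw [← row_dotProduct]
      exact hlt _ (Submodule.subset_span ⟨k, by simpa using hk, rfl⟩)
    · rwa [← row_dotProduct]
  obtain ⟨c, hc⟩ := (Submodule.mem_span_image_finset_iff_exists_fun' R).1 row_mem_span
  refine ⟨Pi.single i 1 - fun k => if i < k then c k else 0,
    fun k hk => ?_, by simp, fun j hj => ?_⟩
  · simp [hk.ne, hk.not_gt]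
  · have hcj : ∑ k with i < k, c k * G k j = G i j := by simpa [row, hj] using congrFun hc j
    rw [sub_vecMul, Pi.sub_apply, single_one_vecMul, row_apply, sub_eq_zero, ← hcj,
      Finset.sum_filter]
    exact Finset.sum_congr rfl fun k _ => by simp

/-- The support of each row of `G` with index in `S` lies in `S`. -/
def IsRowClosed [Zero R] (G : Matrix ι ι R) (S : Set ι) : Prop :=
  ∀ i ∈ S, ∀ j, G i j ≠ 0 → j ∈ S

theorem IsRowClosed.isRecoverable_iff [Fintype ι] [DecidableEq ι] [Preorder ι] [Semiring R]
    [Nontrivial R] {G : Matrix ι ι R} {S : Set ι} (hS : IsRowClosed G S) (hG : G * G = 1) {i : ι} :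
    IsRecoverable G S i ↔ i ∉ S := by
  constructor
  · rintro ⟨h, hhS, -, hi⟩ hiS
    have hGh : (G *ᵥ h) i = 0 := Finset.sum_eq_zero fun j _ => by
      by_cases hij : G i j = 0
      · exact mul_eq_zero_of_left hij _
      · exact mul_eq_zero_of_right _ (hhS j (hS i hiS j hij))
    exact zero_ne_one (hGh.symm.trans hi)
  · intro hiS
    refine (isRecoverable_iff_of_mul_self_eq_one hG).2
      ⟨Pi.single i 1, fun k hk => Pi.single_eq_of_ne hk.ne' 1, Pi.single_eq_same i 1,
        fun j hj => ?_⟩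
    rw [mulVec_single_one]
    by_contra hji
    exact hiS (hS j hj i hji)

end Recoverability

section BinaryVectors

theorem support_injective_zmod_two {ι : Type*} : Injective (support : (ι → ZMod 2) → Set ι) := by
  intro P Q h
  have eq_of_ne_zero_iff : ∀ a b : ZMod 2, (a ≠ 0 ↔ b ≠ 0) → a = b := by decide
  exact funext fun j => eq_of_ne_zero_iff _ _ (Set.ext_iff.1 h j)

theorem ne_zero_iff_eq_one {a : ZMod 2} : a ≠ 0 ↔ a = 1 := by
  revert a
  decide

theorem support_bitOr {ι : Type*} {N : ℕ} (L : Finset ι) (A : ι → BinVec N) :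
    support (bitOr L A) = ⋃ l ∈ L, support (A l) := by
  ext j
  simp only [mem_support, Set.mem_iUnion, exists_prop, ne_zero_iff_eq_one]
  unfold bitOr
  split_ifs with h <;> simp [h]

theorem exists_eq_bitOr_row_iff {N : ℕ} {G : Matrix (Fin N) (Fin N) (ZMod 2)}
    (hrefl : ∀ i, G i i ≠ 0) (htrans : ∀ i j k, G i j ≠ 0 → G j k ≠ 0 → G i k ≠ 0) {P : BinVec N} :
    (∃ L : Finset (Fin N), P = bitOr L fun i => G.row i) ↔ IsRowClosed G (support P) := by
  classical
  simp_rw [← support_injective_zmod_two.eq_iff, support_bitOr]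
  constructor
  · rintro ⟨L, hL⟩ i hi j hij
    simp only [hL, Set.mem_iUnion] at hi ⊢
    obtain ⟨l, hl, hli⟩ := hi
    exact ⟨l, hl, htrans l i j hli hij⟩
  · intro hP
    refine ⟨({i | P i ≠ 0} : Finset (Fin N)), Set.Subset.antisymm (fun j hj => ?_) ?_⟩
    · exact Set.mem_biUnion (by simpa using hj) (hrefl j)
    · exact Set.iUnion₂_subset fun i hi j hij => hP i (by simpa using hi) j hij

end BinaryVectors

section PolarMatrix

theorem lor_lt_lor_of_land_eq_zero {a b d : ℕ} (hab : a < b) (hbd : b &&& d = 0) :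
    a ||| d < b ||| d := by
  obtain ⟨t, ht, heq⟩ := Nat.exists_most_significant_bit (Nat.xor_ne_zero_iff.2 hab.ne)
  have heq' (s : ℕ) (hs : t < s) : a.testBit s = b.testBit s := by simpa using heq s hs
  cases hb : b.testBit t with
  | false =>
    have ha : a.testBit t = true := by simpa [hb] using ht
    exact absurd (Nat.lt_of_testBit t hb ha fun s hs => (heq' s hs).symm) hab.not_gt
  | true =>
    have ha : a.testBit t = false := by simpa [hb] using ht
    have hd : d.testBit t = false := by simpa [hb] using congrArg (Nat.testBit · t) hbd
    exact Nat.lt_of_testBit t (by simp [ha, hd]) (by simp [hb]) fun s hs => by simp [heq' s hs]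

theorem exists_lor_eq_of_lor_eq {a b : ℕ} (h : a ||| b = b) :
    a ||| (b ^^^ a) = b ∧ a &&& (b ^^^ a) = 0 := by
  have htest (t : ℕ) := congrArg (Nat.testBit · t) h
  constructor <;> refine Nat.eq_of_testBit_eq fun t => ?_ <;> grind

theorem lor_lor_eq_right_iff {a b c : ℕ} : (a ||| b) ||| c = c ↔ a ||| c = c ∧ b ||| c = c := by
  simp only [Nat.eq_iff_testBit_eq]
  grind

theorem two_pow_mul_add_lor_eq_iff {n a b i j : ℕ} (hi : i < 2 ^ n) (hj : j < 2 ^ n) :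
    (2 ^ n * b + j) ||| (2 ^ n * a + i) = 2 ^ n * a + i ↔ b ||| a = a ∧ j ||| i = i := by
  have eq_iff (x y : ℕ) : x = y ↔ x / 2 ^ n = y / 2 ^ n ∧ x % 2 ^ n = y % 2 ^ n :=
    ⟨fun h => by simp [h], fun h => by rw [← Nat.div_add_mod x (2 ^ n), h.1, h.2, Nat.div_add_mod]⟩
  rw [eq_iff, Nat.or_div_two_pow, Nat.or_mod_two_pow]
  simp [Nat.mul_add_div, Nat.div_eq_of_lt, Nat.mod_eq_of_lt, hi, hj]

/-- The identification of the pair `(a, j)` with the index `2 ^ n * a + j` used in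
`polarMatrix`. -/
def pairEquiv (n : ℕ) : Fin 2 × Fin (2 ^ n) ≃ Fin (2 ^ (n + 1)) :=
  finProdFinEquiv.trans (finCongr (pow_succ' 2 n).symm)

theorem val_pairEquiv (n : ℕ) (a : Fin 2) (j : Fin (2 ^ n)) :
    (pairEquiv n (a, j) : ℕ) = 2 ^ n * a + j := by
  simp [pairEquiv, finProdFinEquiv, add_comm]

theorem polarMatrix_succ (n : ℕ) :
    polarMatrix (n + 1) =
      reindex (pairEquiv n) (pairEquiv n) (kronecker kernelMatrix (polarMatrix n)) := rfl

theorem polarMatrix_apply (n : ℕ) (i j : Fin (2 ^ n)) :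
    polarMatrix n i j = if j ||| i = i then 1 else 0 := by
  induction n with
  | zero =>
    obtain rfl : j = i := Subsingleton.elim (α := Fin 1) j i
    simp [polarMatrix, Fin.ext_iff]
  | succ n ih =>
    have kernelMatrix_apply : ∀ a b : Fin 2,
        kernelMatrix a b = if (b : ℕ) ||| a = a then 1 else 0 := by
      intro a b
      fin_cases a <;> fin_cases b <;> rfl
    obtain ⟨⟨a, i⟩, rfl⟩ := (pairEquiv n).surjective i
    obtain ⟨⟨b, j⟩, rfl⟩ := (pairEquiv n).surjective j
    have lor_eq_iff : pairEquiv n (b, j) ||| pairEquiv n (a, i) = pairEquiv n (a, i) ↔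
        (b : ℕ) ||| a = a ∧ j ||| i = i := by
      simp only [Fin.ext_iff, Fin.or_val_of_two_pow, val_pairEquiv]
      exact two_pow_mul_add_lor_eq_iff i.isLt j.isLt
    simp only [polarMatrix_succ, reindex_apply, submatrix_apply, Equiv.symm_apply_apply,
      kronecker, kroneckerMap_apply, ih, kernelMatrix_apply, lor_eq_iff, ite_and, ite_mul, one_mul,
      zero_mul]

theorem polarMatrix_ne_zero_iff {n : ℕ} {i j : Fin (2 ^ n)} :
    polarMatrix n i j ≠ 0 ↔ (j : ℕ) ||| i = i := by
  rw [polarMatrix_apply, ne_eq, ite_eq_right_iff, Classical.not_imp, and_iff_left one_ne_zero,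
    Fin.ext_iff, Fin.or_val_of_two_pow]

theorem polarMatrix_self_ne_zero {n : ℕ} (i : Fin (2 ^ n)) : polarMatrix n i i ≠ 0 :=
  polarMatrix_ne_zero_iff.2 (Nat.or_self _)

theorem polarMatrix_ne_zero_trans {n : ℕ} (i j k : Fin (2 ^ n)) (hij : polarMatrix n i j ≠ 0)
    (hjk : polarMatrix n j k ≠ 0) : polarMatrix n i k ≠ 0 := by
  rw [polarMatrix_ne_zero_iff] at *
  rw [← hij, ← Nat.or_assoc, hjk]

theorem polarMatrix_lor_right {n : ℕ} (i j k : Fin (2 ^ n)) :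
    polarMatrix n i (j ||| k) = polarMatrix n i j * polarMatrix n i k := by
  simp only [polarMatrix_apply, Fin.ext_iff, Fin.or_val_of_two_pow, lor_lor_eq_right_iff, ite_and,
    ite_mul, one_mul, zero_mul]

theorem polarMatrix_mul_self (n : ℕ) : polarMatrix n * polarMatrix n = 1 := by
  induction n with
  | zero => exact one_mul 1
  | succ n ih =>
    have kernelMatrix_mul_self : kernelMatrix * kernelMatrix = 1 := by decide
    rw [polarMatrix_succ, reindex_apply, submatrix_mul_equiv]
    rw [kronecker, ← mul_kronecker_mul, kernelMatrix_mul_self, ih, one_kronecker_one,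
      submatrix_one_equiv]

theorem IsRecoverable.of_polarMatrix_ne_zero {n : ℕ} {S : Set (Fin (2 ^ n))} {i j : Fin (2 ^ n)}
    (hj : IsRecoverable (polarMatrix n) S j) (hij : polarMatrix n i j ≠ 0) :
    IsRecoverable (polarMatrix n) S i := by
  rw [isRecoverable_iff_of_mul_self_eq_one (polarMatrix_mul_self n)] at hj ⊢
  obtain ⟨v, hlt, h_one, hS⟩ := hj
  obtain ⟨h_lor, h_land⟩ := exists_lor_eq_of_lor_eq (polarMatrix_ne_zero_iff.1 hij)
  -- The coefficients of the polynomial `v` multiplied by the monomial `x^(i ^^^ j)`.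
  let w : BinVec (2 ^ n) := ∑ m, Pi.single (m ||| (i ^^^ j)) (v m)
  have lor_lt {m : Fin (2 ^ n)} (hm : m < j) : m ||| (i ^^^ j) < i := by
    simpa [Fin.lt_def, h_lor] using lor_lt_lor_of_land_eq_zero hm h_land
  have j_lor : j ||| (i ^^^ j) = i := by simpa [Fin.ext_iff] using h_lor
  have w_apply {k : Fin (2 ^ n)} (hk : i ≤ k) : w k = (Pi.single i 1 : BinVec (2 ^ n)) k := by
    unfold w
    rw [Finset.sum_apply, Finset.sum_eq_single j (fun m _ hm => ?_) (by simp), j_lor, h_one]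
    rcases hm.lt_or_gt with hm | hm
    · exact Pi.single_eq_of_ne ((lor_lt hm).trans_le hk).ne' _
    · rw [hlt m hm, Pi.single_zero, Pi.zero_apply]
  refine ⟨w, fun k hk => ?_, ?_, fun l hl => ?_⟩
  · rw [w_apply hk.le, Pi.single_eq_of_ne hk.ne']
  · rw [w_apply le_rfl, Pi.single_eq_same]
  · calc (polarMatrix n *ᵥ w) l = ∑ m, polarMatrix n l (m ||| (i ^^^ j)) * v m := by
          simp [w, mulVec_sum, mulVec_single, mul_comm]
      _ = polarMatrix n l (i ^^^ j) * (polarMatrix n *ᵥ v) l := by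
          simp only [polarMatrix_lor_right, mulVec, dotProduct, Finset.mul_sum]
          exact Finset.sum_congr rfl fun m _ => by ring
      _ = 0 := by rw [hS l hl, mul_zero]

theorem isRowClosed_setOf_not_isRecoverable {n : ℕ} (S : Set (Fin (2 ^ n))) :
    IsRowClosed (polarMatrix n) {i | ¬ IsRecoverable (polarMatrix n) S i} :=
  fun _ hi _ hij hj => hi (hj.of_polarMatrix_ne_zero hij)

end PolarMatrix

section SymmetricCapacity

variable {Y : Type*} [MeasurableSpace Y]

theorem outputLaw_eq (V : ZMod 2 → Measure Y) :
    outputLaw V = (1 / 2 : ℝ≥0∞) • V 0 + (1 / 2 : ℝ≥0∞) • V 1 :=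
  Fin.sum_univ_two _

instance isFiniteMeasure_outputLaw (V : ZMod 2 → Measure Y) [∀ x, IsFiniteMeasure (V x)] :
    IsFiniteMeasure (outputLaw V) := by
  have (x : ZMod 2) : IsFiniteMeasure ((1 / 2 : ℝ≥0∞) • V x) := Measure.smul_finite _ (by simp)
  rw [outputLaw_eq]
  infer_instance

theorem symmetricCapacity_eq_zero_iff (V : ZMod 2 → Measure Y) [∀ x, IsFiniteMeasure (V x)] :
    symmetricCapacity V = 0 ↔ V 0 = V 1 := by
  calc symmetricCapacity V = 0 ↔ ∀ x, V x = outputLaw V := by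
        simp [symmetricCapacity, ENNReal.div_eq_zero_iff, InformationTheory.klDiv_eq_zero_iff]
    _ ↔ V 0 = V 1 := ?_
  refine ⟨fun h => (h 0).trans (h 1).symm, fun h => ?_⟩
  have h_output : outputLaw V = V 1 := by
    rw [outputLaw_eq, h, ← add_smul, ENNReal.add_halves, one_smul]
  exact Fin.forall_fin_two.2 ⟨h.trans h_output.symm, h_output.symm⟩

end SymmetricCapacity

section ErasedBits

variable {Y : Type*} [MeasurableSpace Y] (W : ZMod 2 → Measure Y)

theorem receivedLaw_congr {N : ℕ} {P x x' : BinVec N} (h : ∀ j ∉ support P, x j = x' j) :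
    receivedLaw W P x = receivedLaw W P x' := by
  unfold receivedLaw
  congr 1
  funext j
  by_cases hj : P j = 1
  · rw [if_pos hj, if_pos hj]
  · rw [if_neg hj, if_neg hj, h j (mt ne_zero_iff_eq_one.1 hj)]

theorem virtualChannel_eq_of_not_isRecoverable {n : ℕ} {P : BinVec (2 ^ n)} {i : Fin (2 ^ n)}
    (hi : ¬ IsRecoverable (polarMatrix n) (support P) i) :
    virtualChannel W P i 0 = virtualChannel W P i 1 := by
  obtain ⟨w, w_lt, w_self, w_vecMul⟩ := exists_vecMul_eq_zero_of_not_isRecoverable hi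
  have add_add_cancel (u : BinVec (2 ^ n)) : u + w + w = u := by
    rw [add_assoc, CharTwo.add_self_eq_zero, add_zero]
  refine Finset.sum_bij' (fun u _ => u + w) (fun u _ => u + w) (fun u hu => ?_) (fun u hu => ?_)
    (fun u _ => add_add_cancel u) (fun u _ => add_add_cancel u) fun u _ => ?_
  · simpa [w_self] using hu
  · simpa [w_self, CharTwo.add_eq_zero] using hu
  · have same_past : (fun k : {k // k < i} => (u + w) k) = fun k : {k // k < i} => u k :=
      funext fun k => by simp [w_lt k k.2]
    have same_law : receivedLaw W P (u ᵥ* polarMatrix n) =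
        receivedLaw W P ((u + w) ᵥ* polarMatrix n) :=
      receivedLaw_congr W fun j hj => by simp [add_vecMul, w_vecMul j hj]
    rw [same_past, same_law]

end ErasedBits

section UnbiasedSigns

/-- The sign `(-1) ^ x` of a bit, the nontrivial character of `ZMod 2`. -/
def signChar : AddChar (ZMod 2) ℝ :=
  AddChar.zmodChar 2 (by norm_num : (-1 : ℝ) ^ 2 = 1)

theorem signChar_one : signChar 1 = -1 := by
  simp [signChar, AddChar.zmodChar_apply, ZMod.val_one]

theorem signChar_dotProduct {ι : Type*} [Fintype ι] (h x : ι → ZMod 2) :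
    signChar (h ⬝ᵥ x) = ∏ j, signChar (h j * x j) :=
  map_prod signChar.toMonoidHom (fun j => Multiplicative.ofAdd (h j * x j)) Finset.univ

variable {Y : Type*} [MeasurableSpace Y] {W : ZMod 2 → Measure Y}

theorem exists_integral_eq_signChar [∀ x, IsProbabilityMeasure (W x)] (hW : W 0 ≠ W 1) :
    ∃ g : Y → ℝ, Measurable g ∧ ∀ x, ∫ y, g y ∂W x = signChar x := by
  obtain ⟨A, hA, hWA⟩ : ∃ A, MeasurableSet A ∧ (W 0).real A ≠ (W 1).real A := by
    by_contra! h
    exact hW (Measure.ext fun A hA => (measureReal_eq_measureReal_iff).1 (h A hA))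
  have hsub : (W 0).real A - (W 1).real A ≠ 0 := sub_ne_zero.2 hWA
  -- The affine function of the indicator of `A` with means `1` and `-1`.
  refine ⟨fun y => (2 * A.indicator 1 y - ((W 0).real A + (W 1).real A)) /
    ((W 0).real A - (W 1).real A), by fun_prop (disch := assumption), fun x => ?_⟩
  have hint : Integrable (A.indicator (1 : Y → ℝ)) (W x) :=
    (integrable_const 1).indicator hA
  rw [integral_div, integral_sub (hint.const_mul 2) (integrable_const _), integral_const_mul,
    integral_indicator_one hA, integral_const, probReal_univ, one_smul, div_eq_iff hsub]
  obtain rfl | rfl := (by decide : ∀ x : ZMod 2, x = 0 ∨ x = 1) x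
  · rw [AddChar.map_zero_eq_one]
    ring
  · rw [signChar_one]
    ring

variable (W) in
/-- The law of one received symbol: the output of `W` for the bit `x`, or the erasure symbol if
`p = 1`. -/
noncomputable def symbolLaw (p x : ZMod 2) : Measure (Y ⊕ Unit) :=
  if p = 1 then Measure.dirac (Sum.inr ()) else (W x).map Sum.inl

instance isProbabilityMeasure_symbolLaw [∀ x, IsProbabilityMeasure (W x)] (p x : ZMod 2) :
    IsProbabilityMeasure (symbolLaw W p x) := by
  unfold symbolLaw
  split_ifs
  · infer_instance
  · exact Measure.isProbabilityMeasure_map measurable_inl.aemeasurable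

theorem receivedLaw_eq_pi {N : ℕ} (P x : BinVec N) :
    receivedLaw W P x = Measure.pi fun j => symbolLaw W (P j) (x j) := rfl

instance isProbabilityMeasure_receivedLaw [∀ x, IsProbabilityMeasure (W x)] {N : ℕ}
    (P x : BinVec N) : IsProbabilityMeasure (receivedLaw W P x) := by
  rw [receivedLaw_eq_pi]
  infer_instance

/-- The estimator of the sign of the parity check `h ⬝ᵥ x` obtained from the received sequence by
multiplying the estimates `g` of the signs of the bits checked by `h`. Erased symbols are given the
estimate `0`. -/
def checkStatistic (g : Y → ℝ) {N : ℕ} (h : BinVec N) (y : Fin N → Y ⊕ Unit) : ℝ :=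
  ∏ j, Sum.elim g 0 (y j) ^ (h j).val

theorem measurable_checkStatistic {g : Y → ℝ} (hg : Measurable g) {N : ℕ} (h : BinVec N) :
    Measurable (checkStatistic g h) := by
  have : Measurable (Sum.elim g (0 : Unit → ℝ)) := hg.sumElim measurable_zero
  unfold checkStatistic
  fun_prop

variable [∀ x, IsProbabilityMeasure (W x)] {g : Y → ℝ}

theorem integral_symbolLaw_sumElim_pow (hg : Measurable g) (hgW : ∀ x, ∫ y, g y ∂W x = signChar x)
    {p h : ZMod 2} (hp : p ≠ 0 → h = 0) (x : ZMod 2) :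
    ∫ z, Sum.elim g 0 z ^ h.val ∂symbolLaw W p x = signChar (h * x) := by
  by_cases hh : h = 0
  · simp [hh]
  · obtain rfl : h = 1 := ne_zero_iff_eq_one.1 hh
    have hp' : p ≠ 1 := fun hp1 => hh (hp (hp1 ▸ one_ne_zero))
    have hmeas : Measurable (Sum.elim g (0 : Unit → ℝ)) := hg.sumElim measurable_zero
    simp only [ZMod.val_one, pow_one, one_mul, symbolLaw, if_neg hp']
    rw [integral_map measurable_inl.aemeasurable hmeas.aestronglyMeasurable]
    exact hgW x

theorem integral_checkStatistic (hg : Measurable g) (hgW : ∀ x, ∫ y, g y ∂W x = signChar x) {N : ℕ}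
    {P h : BinVec N} (hP : ∀ j ∈ support P, h j = 0) (x : BinVec N) :
    ∫ y, checkStatistic g h y ∂receivedLaw W P x = signChar (h ⬝ᵥ x) := by
  rw [signChar_dotProduct, receivedLaw_eq_pi]
  exact (integral_fintype_prod_eq_prod fun j z => Sum.elim g 0 z ^ (h j).val).trans
    (Finset.prod_congr rfl fun j _ => integral_symbolLaw_sumElim_pow hg hgW (hP j) (x j))

end UnbiasedSigns

section RecoverableBits

variable {Y : Type*} [MeasurableSpace Y] {W : ZMod 2 → Measure Y} {n : ℕ} {P : BinVec (2 ^ n)}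
  {i : Fin (2 ^ n)}

instance isFiniteMeasure_virtualChannel [∀ x, IsProbabilityMeasure (W x)] (b : ZMod 2) :
    IsFiniteMeasure (virtualChannel W P i b) := by
  have (u : BinVec (2 ^ n)) : IsFiniteMeasure ((1 / 2 ^ (2 ^ n - 1) : ℝ≥0∞) •
      (receivedLaw W P (u ᵥ* polarMatrix n)).map fun y => (y, fun k : {k // k < i} => u k)) :=
    Measure.smul_finite _ (by simp)
  unfold virtualChannel
  infer_instance

theorem card_filter_apply_eq {N : ℕ} (i : Fin N) (b : ZMod 2) :
    ({u | u i = b} : Finset (BinVec N)).card = 2 ^ (N - 1) := by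
  simpa using Fintype.card_filter_piFinset_const_eq_of_mem (Finset.univ : Finset (ZMod 2)) i
    (Finset.mem_univ b)

theorem integral_virtualChannel {F : (Fin (2 ^ n) → Y ⊕ Unit) × ({k // k < i} → ZMod 2) → ℝ}
    (hF : Measurable F) {b : ZMod 2} (hint : ∀ u : BinVec (2 ^ n), u i = b →
      Integrable (fun y => F (y, fun k => u k)) (receivedLaw W P (u ᵥ* polarMatrix n))) :
    ∫ z, F z ∂virtualChannel W P i b = (2 ^ (2 ^ n - 1))⁻¹ *
      ∑ u : BinVec (2 ^ n) with u i = b,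
        ∫ y, F (y, fun k => u k) ∂receivedLaw W P (u ᵥ* polarMatrix n) := by
  unfold virtualChannel
  rw [integral_finsetSum_measure, Finset.mul_sum]
  · refine Finset.sum_congr rfl fun u _ => ?_
    rw [integral_smul_measure, integral_map (by fun_prop) hF.aestronglyMeasurable]
    simp
  · intro u hu
    refine Integrable.smul_measure ?_ (by simp)
    rw [integrable_map_measure hF.aestronglyMeasurable (by fun_prop)]
    exact hint u (by simpa using hu)

theorem dotProduct_vecMul_eq_sum_add {ι κ R : Type*} [Fintype ι] [LinearOrder ι] [Fintype κ]
    [CommSemiring R] {G : Matrix ι κ R} {h : κ → R} {i : ι} (hlt : ∀ k, i < k → (G *ᵥ h) k = 0)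
    (hi : (G *ᵥ h) i = 1) (u : ι → R) :
    h ⬝ᵥ (u ᵥ* G) = ∑ k : {k // k < i}, (G *ᵥ h) k * u k + u i := by
  have sum_not_lt : ∑ k : {k // ¬ k < i}, (G *ᵥ h) k * u k = u i := by
    rw [Fintype.sum_eq_single ⟨i, lt_irrefl i⟩ fun k hk => ?_, hi, one_mul]
    rw [hlt k ((not_lt.1 k.2).lt_of_ne fun h => hk (Subtype.ext h.symm)), zero_mul]
  rw [dotProduct_comm, ← dotProduct_mulVec, dotProduct_comm, ← sum_not_lt]
  exact (Fintype.sum_subtype_add_sum_subtype (· < i) fun k => (G *ᵥ h) k * u k).symm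

theorem virtualChannel_ne_of_isRecoverable [∀ x, IsProbabilityMeasure (W x)] (hW : W 0 ≠ W 1)
    (hi : IsRecoverable (polarMatrix n) (support P) i) :
    virtualChannel W P i 0 ≠ virtualChannel W P i 1 := by
  obtain ⟨g, hg, hgW⟩ := exists_integral_eq_signChar hW
  obtain ⟨h, hP, hlt, h_one⟩ := hi
  let F (z : (Fin (2 ^ n) → Y ⊕ Unit) × ({k // k < i} → ZMod 2)) : ℝ :=
    checkStatistic g h z.1 * signChar (∑ k : {k // k < i}, (polarMatrix n *ᵥ h) k * z.2 k)
  have F_measurable : Measurable F :=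
    ((measurable_checkStatistic hg h).comp measurable_fst).mul
      ((Measurable.of_discrete (f := fun t : {k // k < i} → ZMod 2 =>
        signChar (∑ k : {k // k < i}, (polarMatrix n *ᵥ h) k * t k))).comp measurable_snd)
  have integral_F_received (u : BinVec (2 ^ n)) :
      ∫ y, F (y, fun k => u k) ∂receivedLaw W P (u ᵥ* polarMatrix n) = signChar (u i) := by
    simp only [F]
    rw [integral_mul_const, integral_checkStatistic hg hgW hP, ← AddChar.map_add_eq_mul,
      dotProduct_vecMul_eq_sum_add hlt h_one, add_right_comm, CharTwo.add_self_eq_zero, zero_add]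
  have integral_F (b : ZMod 2) : ∫ z, F z ∂virtualChannel W P i b = signChar b := by
    rw [integral_virtualChannel F_measurable fun u _ =>
        Integrable.of_integral_ne_zero (integral_F_received u ▸ (signChar.val_isUnit _).ne_zero),
      Finset.sum_congr rfl fun u hu =>
        (integral_F_received u).trans (congrArg signChar (Finset.mem_filter.1 hu).2),
      Finset.sum_const, card_filter_apply_eq]
    simp
  intro heq
  have signChar_zero_eq : signChar 0 = signChar 1 := by rw [← integral_F, heq, integral_F]
  norm_num [signChar_one] at signChar_zero_eq

end RecoverableBits

section ErasurePattern

variable {Y : Type*} [MeasurableSpace Y] {W : ZMod 2 → Measure Y}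
  [∀ x, IsProbabilityMeasure (W x)] {n : ℕ}

theorem support_erasurePattern (hW : 0 < symmetricCapacity W) (P : BinVec (2 ^ n)) :
    support (erasurePattern W P) = {i | ¬ IsRecoverable (polarMatrix n) (support P) i} := by
  have hW01 : W 0 ≠ W 1 := mt (symmetricCapacity_eq_zero_iff W).2 hW.ne'
  ext i
  calc erasurePattern W P i ≠ 0 ↔ symmetricCapacity (virtualChannel W P i) = 0 := by
        simp [erasurePattern]
    _ ↔ virtualChannel W P i 0 = virtualChannel W P i 1 := symmetricCapacity_eq_zero_iff _
    _ ↔ ¬ IsRecoverable (polarMatrix n) (support P) i :=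
        ⟨fun h hi => virtualChannel_ne_of_isRecoverable hW01 hi h,
          virtualChannel_eq_of_not_isRecoverable W⟩

theorem isRowClosed_support_erasurePattern (hW : 0 < symmetricCapacity W) (P : BinVec (2 ^ n)) :
    IsRowClosed (polarMatrix n) (support (erasurePattern W P)) := by
  rw [support_erasurePattern hW]
  exact isRowClosed_setOf_not_isRecoverable _

theorem erasurePattern_eq_self_iff (hW : 0 < symmetricCapacity W) {P : BinVec (2 ^ n)} :
    erasurePattern W P = P ↔ IsRowClosed (polarMatrix n) (support P) := by
  refine ⟨fun h => h ▸ isRowClosed_support_erasurePattern hW P, fun hP => ?_⟩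
  refine support_injective_zmod_two ?_
  rw [support_erasurePattern hW]
  ext i
  rw [Set.mem_ofPred_eq, hP.isRecoverable_iff (polarMatrix_mul_self n), not_not]

end ErasurePattern

end PolarPuncturing

theorem mainTheorem1 (n : ℕ) (P : PolarPuncturing.BinVec (2 ^ n))
    {Y : Type*} [MeasurableSpace Y] (W : ZMod 2 → MeasureTheory.Measure Y)
    [∀ x, MeasureTheory.IsProbabilityMeasure (W x)]
    (hW : 0 < PolarPuncturing.symmetricCapacity W) :
    (PolarPuncturing.erasurePattern W P = P ↔
      P = 0 ∨ ∃ L : Finset (Fin (2 ^ n)),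
        P = PolarPuncturing.bitOr L (fun i => (PolarPuncturing.polarMatrix n).row i)) ∧
    (∃ L : Finset (Fin (2 ^ n)),
      PolarPuncturing.erasurePattern W P =
        PolarPuncturing.bitOr L (fun i => (PolarPuncturing.polarMatrix n).row i)) ∧
    (∀ {Y' : Type*} [MeasurableSpace Y'] (W' : ZMod 2 → MeasureTheory.Measure Y')
      [∀ x, MeasureTheory.IsProbabilityMeasure (W' x)],
      0 < PolarPuncturing.symmetricCapacity W' →
        PolarPuncturing.erasurePattern W' P = PolarPuncturing.erasurePattern W P) := by
  open PolarPuncturing in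
  have eq_bitOr_iff (Q : BinVec (2 ^ n)) :=
    exists_eq_bitOr_row_iff (P := Q) polarMatrix_self_ne_zero polarMatrix_ne_zero_trans
  refine ⟨?_, (eq_bitOr_iff _).2 (isRowClosed_support_erasurePattern hW P), fun W' _ hW' => ?_⟩
  · rw [erasurePattern_eq_self_iff hW, eq_bitOr_iff, or_iff_right_of_imp]
    rintro rfl
    simp [IsRowClosed]
  · refine support_injective_zmod_two ?_
    rw [support_erasurePattern hW', support_erasurePattern hW]
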